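/- Let $(M,\omega)$ be a closed symplectic manifold of dimension $2n$, i.e. a compact smooth Hausdorff manifold without boundary with a smooth closed nondegenerate 2-form $\omega$. Let $\mathrm{Symp}(M,\omega)$ be its group of symplectomorphisms with the $C^\infty$-topology, and let $\mathrm{Symp}_0(M,\omega)$ be the connected component of the identity. A Hamiltonian path generated by $(F_t)_{t\in[0,1]}$ is a path $(\varphi_t)_{t\in[0,1]}$ in $\mathrm{Symp}(M,\omega)$, smooth in $(t,x)$, such that $F$ is a smooth function on $[0,1]\times M$ with $\int_M F_t\,\omega^n=0$ and $\omega(\tfrac{d}{dt}\varphi_t(x),\cdot)=dF_t$ at $\varphi_t(x)$ for all $t$ and $x$. Let $\mathrm{Ham}(M,\omega)$ be the set of endpoints $\varphi_1$ of Hamiltonian paths with $\varphi_0=\mathrm{id}$. For $f\in\mathrm{Ham}(M,\omega)$ let the Hofer norm be $$\rho(f)=\inf\int_0^1\max_{x\in M}|F_t(x)|\,dt,$$ the infimum being taken over all Hamiltonian paths from $\mathrm{id}$ to $f$ and the functions $F_t$ generating them. For $K>0$ and $\phi\in\mathrm{Symp}_0(M,\omega)$ put $$\rho_K(\phi)=\begin{cases}\min(\rho(\phi),K),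 & \phi\in\mathrm{Ham}(M,\omega),\\ K, & \text{otherwise,}\end{cases}$$ and let the $\rho_K$-topology on $\mathrm{Symp}_0(M,\omega)$ be the topology defined by the distance function $d(\phi,\psi)=\rho_K(\phi\psi^{-1})$. Then, for every $K>0$, the connected component of the identity of $\mathrm{Symp}_0(M,\omega)$ with respect to the $\rho_K$-topology is $\mathrm{Ham}(M,\omega)$. -/

import Mathlib

open Set MeasureTheory Manifold
open scoped ContDiff

noncomputable section

section Definitions

variable {n : ℕ} {M : Type*} [TopologicalSpace M] [ChartedSpace (EuclideanSpace ℝ (Fin (2 * n))) M]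

/-- The expression, in the preferred chart around `x`, of a field `α` of alternating bilinear forms
on the tangent spaces of `M`: the pull-back of `α` by the inverse of the chart. It is meaningful
on the target of the chart, which is an open subset of `ℝ²ⁿ`. -/
def formInChart (α : ∀ p : M, (TangentSpace (𝓡 (2 * n)) p) [⋀^Fin 2]→L[ℝ] ℝ) (x : M) :
    EuclideanSpace ℝ (Fin (2 * n)) → (EuclideanSpace ℝ (Fin (2 * n))) [⋀^Fin 2]→L[ℝ] ℝ :=
  fun y ↦ (α ((extChartAt (𝓡 (2 * n)) x).symm y)).compContinuousLinearMap
    (mfderiv (𝓡 (2 * n)) (𝓡 (2 * n)) (extChartAt (𝓡 (2 * n)) x).symm y)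

variable (n M) in
/-- A symplectic form on a `2n`-dimensional manifold `M` without boundary: a smooth closed
nondegenerate differential 2-form. Smoothness and closedness are read off in charts. -/
structure SymplecticForm where
  /-- the underlying field of alternating bilinear forms -/
  form : ∀ p : M, (TangentSpace (𝓡 (2 * n)) p) [⋀^Fin 2]→L[ℝ] ℝ
  smooth : ∀ x : M, ContDiffOn ℝ ∞ (formInChart form x) (extChartAt (𝓡 (2 * n)) x).target
  closed : ∀ x : M, ∀ y ∈ (extChartAt (𝓡 (2 * n)) x).target, extDeriv (formInChart form x) y = 0
  nondegenerate : ∀ (p : M) (v : TangentSpace (𝓡 (2 * n)) p),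
    (∀ w : TangentSpace (𝓡 (2 * n)) p, form p ![v, w] = 0) → v = 0

/-- The measure induced by the volume form `σⁿ / n!`. In a chart it has density
`|Pf (σ_ij)| = √|det (σ_ij)|` with respect to the Lebesgue measure; these measures on the chart
domains agree on overlaps, so their supremum is the measure on `M` that restricts to each of
them. -/
def liouvilleMeasure [MeasurableSpace M] (σ : SymplecticForm n M) : Measure M :=
  ⨆ x : M, Measure.map (extChartAt (𝓡 (2 * n)) x).symm
    ((volume.restrict (extChartAt (𝓡 (2 * n)) x).target).withDensity fun y ↦
      ENNReal.ofReal (Real.sqrt |(Matrix.of fun i j : Fin (2 * n) ↦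
        formInChart σ.form x y
          ![EuclideanSpace.single i (1 : ℝ), EuclideanSpace.single j (1 : ℝ)]).det|))

/-- A map `f : M → M` preserves `σ` if `f^* σ = σ`. -/
def PreservesForm (σ : SymplecticForm n M) (f : M → M) : Prop :=
  ∀ p : M, (σ.form (f p)).compContinuousLinearMap
    (mfderiv (𝓡 (2 * n)) (𝓡 (2 * n)) f p) = σ.form p

/-- The group `Symp(M, σ)` of symplectomorphisms: smooth diffeomorphisms preserving `σ`. -/
def Symp (σ : SymplecticForm n M) : Type _ :=
  {f : M ≃ₘ⟮𝓡 (2 * n), 𝓡 (2 * n)⟯ M // PreservesForm σ f}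

theorem PreservesForm.id (σ : SymplecticForm n M) : PreservesForm σ (fun p : M ↦ p) := by
  intro p
  have h : mfderiv (𝓡 (2 * n)) (𝓡 (2 * n)) (fun p : M ↦ p) p = ContinuousLinearMap.id ℝ _ :=
    mfderiv_id
  rw [h]
  rfl

theorem PreservesForm.comp (σ : SymplecticForm n M) {f g : M → M}
    (hf : PreservesForm σ f) (hg : PreservesForm σ g)
    (sf : MDifferentiable (𝓡 (2 * n)) (𝓡 (2 * n)) f)
    (sg : MDifferentiable (𝓡 (2 * n)) (𝓡 (2 * n)) g) : PreservesForm σ (fun p ↦ f (g p)) := by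
  intro p
  have h : mfderiv (𝓡 (2 * n)) (𝓡 (2 * n)) (fun p ↦ f (g p)) p =
      (mfderiv (𝓡 (2 * n)) (𝓡 (2 * n)) f (g p)).comp (mfderiv (𝓡 (2 * n)) (𝓡 (2 * n)) g p) :=
    mfderiv_comp p (sf (g p)) (sg p)
  rw [h, ← hg p, ← hf (g p)]
  rfl

theorem PreservesForm.symm (σ : SymplecticForm n M) (f : M ≃ₘ⟮𝓡 (2 * n), 𝓡 (2 * n)⟯ M)
    (hf : PreservesForm σ f) : PreservesForm σ f.symm := by
  intro p
  have h : (mfderiv (𝓡 (2 * n)) (𝓡 (2 * n)) f (f.symm p)).comp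
      (mfderiv (𝓡 (2 * n)) (𝓡 (2 * n)) f.symm p) = ContinuousLinearMap.id ℝ _ := by
    have h1 := mfderiv_comp (I := 𝓡 (2 * n)) (I' := 𝓡 (2 * n)) (I'' := 𝓡 (2 * n)) p
      (f.contMDiff.mdifferentiable (by simp) (f.symm p))
      (f.symm.contMDiff.mdifferentiable (by simp) p)
    have h2 : (f ∘ f.symm : M → M) = _root_.id := by
      funext q; simp
    rw [h2, mfderiv_id] at h1
    exact h1.symm
  have h3 := congrArg (fun α ↦ α.compContinuousLinearMap
    (mfderiv (𝓡 (2 * n)) (𝓡 (2 * n)) f.symm p)) (hf (f.symm p))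
  refine h3.symm.trans ?_
  have h4 : f (f.symm p) = p := by simp
  ext v
  change σ.form (f (f.symm p)) (fun i ↦ ((mfderiv (𝓡 (2 * n)) (𝓡 (2 * n)) f (f.symm p)).comp
      (mfderiv (𝓡 (2 * n)) (𝓡 (2 * n)) f.symm p)) (v i)) = σ.form p v
  rw [h]
  change σ.form (f (f.symm p)) v = σ.form p v
  rw [h4]

/-- Symplectomorphisms form a group under composition, `(f * g) p = f (g p)`. -/
instance (σ : SymplecticForm n M) : Group (Symp σ) where
  mul f g := ⟨g.1.trans f.1, PreservesForm.comp σ (f := f.1) (g := g.1) f.2 g.2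
    (f.1.contMDiff.mdifferentiable (by simp)) (g.1.contMDiff.mdifferentiable (by simp))⟩
  one := ⟨Diffeomorph.refl _ _ _, PreservesForm.id σ⟩
  inv f := ⟨f.1.symm, PreservesForm.symm σ f.1 f.2⟩
  mul_assoc _ _ _ := rfl
  one_mul _ := rfl
  mul_one _ := rfl
  inv_mul_cancel f := Subtype.ext (Diffeomorph.ext fun p ↦ f.1.symm_apply_apply p)

instance (σ : SymplecticForm n M) : CoeFun (Symp σ) fun _ ↦ M → M := ⟨fun f ↦ f.1⟩

/-- The expression of `f : M → M` in the preferred charts around `x` and `y`. -/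
def mapInCharts (f : M → M) (x y : M) :
    EuclideanSpace ℝ (Fin (2 * n)) → EuclideanSpace ℝ (Fin (2 * n)) :=
  fun u ↦ extChartAt (𝓡 (2 * n)) y (f ((extChartAt (𝓡 (2 * n)) x).symm u))

/-- The basic `C^k`-neighbourhood of `f` given by the charts around `x` and `y`, a set `A` in the
first chart domain and `ε`: all `g` that map `A` into the second chart domain and whose derivatives
up to order `k` in these charts are `ε`-close to those of `f` on `A`. -/
def basicNhd (σ : SymplecticForm n M) (f : Symp σ) (k : ℕ) (x y : M) (A : Set M) (ε : ℝ) :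
    Set (Symp σ) :=
  {g | MapsTo g A (extChartAt (𝓡 (2 * n)) y).source ∧
    ∀ p ∈ A, ∀ j ≤ k,
      ‖iteratedFDeriv ℝ j (mapInCharts (n := n) g x y) (extChartAt (𝓡 (2 * n)) x p) -
        iteratedFDeriv ℝ j (mapInCharts (n := n) f x y) (extChartAt (𝓡 (2 * n)) x p)‖ < ε}

/-- The `C^∞`-topology on `Symp(M, σ)`. -/
@[reducible] def smoothTopology (σ : SymplecticForm n M) : TopologicalSpace (Symp σ) :=
  TopologicalSpace.generateFrom
    {U | ∃ (f : Symp σ) (k : ℕ) (x y : M) (A : Set M) (ε : ℝ),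
      IsCompact A ∧ A ⊆ (extChartAt (𝓡 (2 * n)) x).source ∧
      MapsTo f A (extChartAt (𝓡 (2 * n)) y).source ∧ 0 < ε ∧ U = basicNhd σ f k x y A ε}

/-- `Symp₀(M, σ)`, the connected component of the identity in `Symp(M, σ)`. -/
def Symp₀ (σ : SymplecticForm n M) : Set (Symp σ) :=
  @connectedComponent (Symp σ) (smoothTopology σ) 1

variable [MeasurableSpace M]

/-- `φ_t`, `t ∈ [0,1]`, is a smooth Hamiltonian path generated by the smooth normalized
time-dependent Hamiltonian function `F_t`, `t ∈ [0,1]`: `σ (dφ_t/dt, ·) = dF_t` at `φ_t(p)`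
for all `p`, and `∫_M F_t σⁿ = 0`. Values at `t ∉ [0,1]` are irrelevant. -/
structure IsHamiltonianPath (σ : SymplecticForm n M) (φ : ℝ → Symp σ) (F : ℝ → M → ℝ) :
    Prop where
  smooth_path : ContMDiffOn (𝓘(ℝ, ℝ).prod (𝓡 (2 * n))) (𝓡 (2 * n)) ∞
    (fun q : ℝ × M ↦ φ q.1 q.2) (Icc 0 1 ×ˢ univ)
  smooth_function : ContMDiffOn (𝓘(ℝ, ℝ).prod (𝓡 (2 * n))) 𝓘(ℝ, ℝ) ∞
    (fun q : ℝ × M ↦ F q.1 q.2) (Icc 0 1 ×ˢ univ)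
  normalized : ∀ t ∈ Icc (0 : ℝ) 1, ∫ p, F t p ∂(liouvilleMeasure σ) = 0
  generates : ∀ t ∈ Icc (0 : ℝ) 1, ∀ (p : M) (w : TangentSpace (𝓡 (2 * n)) (φ t p)),
    σ.form (φ t p)
      ![mfderivWithin 𝓘(ℝ, ℝ) (𝓡 (2 * n)) (fun s : ℝ ↦ φ s p) (Icc 0 1) t (1 : ℝ), w] =
    mfderiv (𝓡 (2 * n)) 𝓘(ℝ, ℝ) (F t) (φ t p) w

/-- `Ham(M, σ)`: the endpoints of Hamiltonian paths that start at the identity. -/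
def Ham (σ : SymplecticForm n M) : Set (Symp σ) :=
  {f | ∃ (φ : ℝ → Symp σ) (F : ℝ → M → ℝ), IsHamiltonianPath σ φ F ∧ φ 0 = 1 ∧ φ 1 = f}

/-- The Finsler length `∫₀¹ ‖F_t‖_∞ dt` of a Hamiltonian path generated by `F_t`. -/
def hoferLength (F : ℝ → M → ℝ) : ℝ :=
  ∫ t in (0 : ℝ)..1, ⨆ p : M, |F t p|

/-- The Hofer norm `ρ(f)` of `f ∈ Ham(M, σ)`: the infimum of the lengths of the Hamiltonian paths
from the identity to `f`. -/
def hoferNorm (σ : SymplecticForm n M) (f : Symp σ) : ℝ :=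
  sInf {l | ∃ (φ : ℝ → Symp σ) (F : ℝ → M → ℝ),
    IsHamiltonianPath σ φ F ∧ φ 0 = 1 ∧ φ 1 = f ∧ l = hoferLength F}

open Classical in
/-- `ρ_K`: equal to `min (ρ, K)` on `Ham(M, σ)` and to `K` elsewhere. -/
def rhoK (σ : SymplecticForm n M) (K : ℝ) (f : Symp σ) : ℝ :=
  if f ∈ Ham σ then min (hoferNorm σ f) K else K

/-- The `ρ_K`-topology on `Symp₀(M, σ)`, that is, the topology of the distance function
`d(f, g) = ρ_K(f g⁻¹)`: a set is open if with each of its points it contains a ball around it. -/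
@[reducible] def rhoKTopology (σ : SymplecticForm n M) (K : ℝ) : TopologicalSpace (Symp₀ σ) where
  IsOpen U := ∀ f ∈ U, ∃ ε > 0, ∀ g : Symp₀ σ, rhoK σ K (f.1 * g.1⁻¹) < ε → g ∈ U
  isOpen_univ _ _ := ⟨1, one_pos, fun _ _ ↦ mem_univ _⟩
  isOpen_inter U V hU hV f hf := by
    obtain ⟨ε, hε, h⟩ := hU f hf.1
    obtain ⟨δ, hδ, h'⟩ := hV f hf.2
    exact ⟨min ε δ, lt_min hε hδ, fun g hg ↦
      ⟨h g (hg.trans_le (min_le_left _ _)), h' g (hg.trans_le (min_le_right _ _))⟩⟩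
  isOpen_sUnion S hS f hf := by
    obtain ⟨U, hU, hfU⟩ := hf
    obtain ⟨ε, hε, h⟩ := hS U hU f hfU
    exact ⟨ε, hε, fun g hg ↦ ⟨U, hU, h g hg⟩⟩

/-- The identity as an element of `Symp₀(M, σ)`. -/
def Symp₀.id (σ : SymplecticForm n M) : Symp₀ σ :=
  ⟨1, @mem_connectedComponent (Symp σ) (smoothTopology σ) 1⟩

end Definitions

end

open Filter Topology

/-! Everything rests on two facts. First, `Ham σ` is a subgroup, and `rhoK σ K f < K` forces `f ∈
Ham σ`. Hence the ball of radius `K` around any point stays in one coset of `Ham σ`, so `Ham σ` is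
clopen (`isClopen_Ham_rhoKTopology`) and contains the component of the identity. Second, a
Hamiltonian path from the identity is continuous in the `C^∞`-topology, so it stays in `Symp₀ σ`. It
is also Lipschitz for the Hofer distance (`exists_hoferNorm_le`), hence continuous in the
`ρ_K`-topology, and it joins its endpoint to the identity. Since the distance is right-invariant,
the only operations needed on paths are reparametrization, right translation and gluing
(`reparam_mul`, `glue`). Nondegeneracy of the Hofer norm plays no role. -/

theorem hoferLength_nonneg {M : Type*} (F : ℝ → M → ℝ) : 0 ≤ hoferLength F :=
  intervalIntegral.integral_nonneg zero_le_one fun _ _ ↦ Real.iSup_nonneg fun _ ↦ abs_nonneg _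

theorem hoferLength_le {M : Type*} {F : ℝ → M → ℝ} {C : ℝ} (hC : 0 ≤ C)
    (h : ∀ t ∈ Icc (0 : ℝ) 1, ∀ p, |F t p| ≤ C) : hoferLength F ≤ C := by
  have h1 := intervalIntegral.norm_integral_le_of_norm_le_const (a := (0 : ℝ)) (b := 1) (C := C)
    (f := fun t ↦ ⨆ p : M, |F t p|) (fun t ht ↦ by
      rw [uIoc_of_le zero_le_one] at ht
      rw [Real.norm_of_nonneg (Real.iSup_nonneg fun _ ↦ abs_nonneg _)]
      exact Real.iSup_le (h t (Ioc_subset_Icc_self ht)) hC)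
  rw [sub_zero, abs_one, mul_one] at h1
  exact (le_abs_self _).trans h1

/-! ### Operations on Hamiltonian paths and the group structure of `Ham σ` -/

section HamiltonianPaths

variable {n : ℕ} {M : Type*} [TopologicalSpace M] [ChartedSpace (EuclideanSpace ℝ (Fin (2 * n))) M]

theorem ContinuousAlternatingMap.map_vecCons_smul {E : Type*} [NormedAddCommGroup E]
    [NormedSpace ℝ E] (α : E [⋀^Fin 2]→L[ℝ] ℝ) (c : ℝ) (v w : E) :
    α ![c • v, w] = c * α ![v, w] := by
  have h := α.map_update_smul ![v, w] 0 c v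
  have h1 (x : E) : Function.update ![v, w] 0 x = ![x, w] := by
    ext i; fin_cases i <;> rfl
  rw [h1, h1] at h
  exact h

theorem Symp.contMDiff {σ : SymplecticForm n M} (f : Symp σ) :
    ContMDiff (𝓡 (2 * n)) (𝓡 (2 * n)) ∞ f := f.1.contMDiff

variable [MeasurableSpace M] {σ : SymplecticForm n M}

theorem isHamiltonianPath_const (f : Symp σ) : IsHamiltonianPath σ (fun _ ↦ f) (fun _ _ ↦ 0) where
  smooth_path := (f.contMDiff.comp contMDiff_snd).contMDiffOn
  smooth_function := contMDiffOn_const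
  normalized _ _ := by simp
  generates t _ p w := by
    rw [mfderivWithin_const, mfderiv_const]
    exact (σ.form (f p)).map_coord_zero 0 rfl

theorem one_mem_Ham : (1 : Symp σ) ∈ Ham σ :=
  ⟨_, _, isHamiltonianPath_const 1, rfl, rfl⟩

theorem IsHamiltonianPath.mdifferentiableAt_function {φ : ℝ → Symp σ} {F : ℝ → M → ℝ}
    (h : IsHamiltonianPath σ φ F) {t : ℝ} (ht : t ∈ Icc (0 : ℝ) 1) (p : M) :
    MDifferentiableAt (𝓡 (2 * n)) 𝓘(ℝ, ℝ) (F t) p := by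
  have h1 : ContMDiffOn (𝓡 (2 * n)) 𝓘(ℝ, ℝ) ∞ (F t) univ :=
    h.smooth_function.comp (contMDiff_const.prodMk contMDiff_id).contMDiffOn
      (fun q _ ↦ ⟨ht, mem_univ _⟩)
  exact (contMDiffOn_univ.1 h1).mdifferentiable (by simp) p

theorem IsHamiltonianPath.mdifferentiableWithinAt_path {φ : ℝ → Symp σ} {F : ℝ → M → ℝ}
    (h : IsHamiltonianPath σ φ F) {t : ℝ} (ht : t ∈ Icc (0 : ℝ) 1) (p : M) :
    MDifferentiableWithinAt 𝓘(ℝ, ℝ) (𝓡 (2 * n)) (fun s ↦ φ s p) (Icc 0 1) t := by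
  have h1 : ContMDiffOn 𝓘(ℝ, ℝ) (𝓡 (2 * n)) ∞ (fun s ↦ φ s p) (Icc 0 1) :=
    h.smooth_path.comp (contMDiff_id.prodMk contMDiff_const).contMDiffOn
      (fun s hs ↦ ⟨hs, mem_univ _⟩)
  exact (h1 t ht).mdifferentiableWithinAt (by simp)

/-- Hamiltonian paths can be reparametrized and multiplied from the right. -/
theorem IsHamiltonianPath.reparam_mul {φ : ℝ → Symp σ} {F : ℝ → M → ℝ}
    (h : IsHamiltonianPath σ φ F) {β : ℝ → ℝ} (hβ : ContDiff ℝ ∞ β)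
    (hm : MapsTo β (Icc 0 1) (Icc 0 1)) (g : Symp σ) :
    IsHamiltonianPath σ (fun t ↦ φ (β t) * g) (fun t p ↦ deriv β t * F (β t) p) where
  smooth_path :=
    h.smooth_path.comp ((hβ.contMDiff.comp contMDiff_fst).prodMk
      (g.contMDiff.comp contMDiff_snd)).contMDiffOn (fun q hq ↦ ⟨hm hq.1, mem_univ _⟩)
  smooth_function := by
    have h1 : ContMDiff (𝓘(ℝ, ℝ).prod (𝓡 (2 * n))) 𝓘(ℝ, ℝ) ∞
        (fun q : ℝ × M ↦ deriv β q.1) :=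
      (contDiff_infty_iff_deriv.1 hβ).2.contMDiff.comp contMDiff_fst
    have h2 : ContMDiffOn (𝓘(ℝ, ℝ).prod (𝓡 (2 * n))) 𝓘(ℝ, ℝ) ∞
        (fun q : ℝ × M ↦ F (β q.1) q.2) (Icc 0 1 ×ˢ univ) :=
      h.smooth_function.comp ((hβ.contMDiff.comp contMDiff_fst).prodMk
        contMDiff_snd).contMDiffOn (fun q hq ↦ ⟨hm hq.1, mem_univ _⟩)
    exact h1.contMDiffOn.smul h2
  normalized t ht := by
    rw [integral_const_mul, h.normalized _ (hm ht), mul_zero]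
  generates t ht p w := by
    have hd : DifferentiableAt ℝ β t := hβ.differentiable (by simp) t
    have hu : UniqueDiffWithinAt ℝ (Icc (0 : ℝ) 1) t := uniqueDiffOn_Icc one_pos t ht
    have h1 : mfderivWithin 𝓘(ℝ, ℝ) (𝓡 (2 * n)) (fun s ↦ φ (β s) (g p)) (Icc 0 1) t =
        (mfderivWithin 𝓘(ℝ, ℝ) (𝓡 (2 * n)) (fun s ↦ φ s (g p)) (Icc 0 1) (β t)).comp
          (mfderivWithin 𝓘(ℝ, ℝ) 𝓘(ℝ, ℝ) β (Icc 0 1) t) :=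
      mfderivWithin_comp t (h.mdifferentiableWithinAt_path (hm ht) (g p))
        hd.mdifferentiableAt.mdifferentiableWithinAt hm hu.uniqueMDiffWithinAt
    have h2 : mfderivWithin 𝓘(ℝ, ℝ) 𝓘(ℝ, ℝ) β (Icc 0 1) t (1 : ℝ) = deriv β t • (1 : ℝ) := by
      rw [mfderivWithin_eq_fderivWithin, hd.fderivWithin hu]
      exact (fderiv_apply_one_eq_deriv (f := β) (x := t)).trans (mul_one _).symm
    have h3 : mfderivWithin 𝓘(ℝ, ℝ) (𝓡 (2 * n)) (fun s ↦ φ (β s) (g p)) (Icc 0 1) t (1 : ℝ) =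
        deriv β t •
          mfderivWithin 𝓘(ℝ, ℝ) (𝓡 (2 * n)) (fun s ↦ φ s (g p)) (Icc 0 1) (β t) (1 : ℝ) := by
      rw [h1]
      refine (congrArg (mfderivWithin 𝓘(ℝ, ℝ) (𝓡 (2 * n)) (fun s ↦ φ s (g p)) (Icc 0 1) (β t))
        h2).trans (ContinuousLinearMap.map_smul _ _ _)
    have h4 : mfderiv (𝓡 (2 * n)) 𝓘(ℝ, ℝ) (fun p ↦ deriv β t * F (β t) p) (φ (β t) (g p)) =
        deriv β t • mfderiv (𝓡 (2 * n)) 𝓘(ℝ, ℝ) (F (β t)) (φ (β t) (g p)) :=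
      const_smul_mfderiv (h.mdifferentiableAt_function (hm ht) _) (deriv β t)
    -- Right translation only replaces the starting point `p` by `g p`, so it leaves the Hamiltonian
    -- unchanged. Reparametrization scales both sides by `deriv β t`.
    change σ.form (φ (β t) (g p)) ![mfderivWithin 𝓘(ℝ, ℝ) (𝓡 (2 * n))
        (fun s ↦ φ (β s) (g p)) (Icc 0 1) t (1 : ℝ), w] =
      mfderiv (𝓡 (2 * n)) 𝓘(ℝ, ℝ) (fun p ↦ deriv β t * F (β t) p) (φ (β t) (g p)) w
    rw [h3, h4]
    refine (ContinuousAlternatingMap.map_vecCons_smul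
      (E := EuclideanSpace ℝ (Fin (2 * n))) _ _ _ _).trans ?_
    exact congrArg (deriv β t * ·) (h.generates (β t) (hm ht) (g p) w)

/-- Being a Hamiltonian path is a local property. -/
theorem IsHamiltonianPath.of_locally {φ : ℝ → Symp σ} {F : ℝ → M → ℝ}
    (h : ∀ t ∈ Icc (0 : ℝ) 1, ∃ φ' F', IsHamiltonianPath σ φ' F' ∧
      ∀ᶠ s in 𝓝 t, φ s = φ' s ∧ F s = F' s) : IsHamiltonianPath σ φ F where
  smooth_path q hq := by
    obtain ⟨φ', F', h', he⟩ := h q.1 hq.1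
    refine (h'.smooth_path q hq).congr_of_eventuallyEq ?_ (by rw [he.self_of_nhds.1])
    filter_upwards [nhdsWithin_le_nhds (continuous_fst.continuousAt.eventually he)] with r hr
    rw [hr.1]
  smooth_function q hq := by
    obtain ⟨φ', F', h', he⟩ := h q.1 hq.1
    refine (h'.smooth_function q hq).congr_of_eventuallyEq ?_ (by rw [he.self_of_nhds.2])
    filter_upwards [nhdsWithin_le_nhds (continuous_fst.continuousAt.eventually he)] with r hr
    rw [hr.2]
  normalized t ht := by
    obtain ⟨φ', F', h', he⟩ := h t ht
    rw [he.self_of_nhds.2]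
    exact h'.normalized t ht
  generates t ht p w := by
    obtain ⟨φ', F', h', he⟩ := h t ht
    have h1 : mfderivWithin 𝓘(ℝ, ℝ) (𝓡 (2 * n)) (fun s ↦ φ s p) (Icc 0 1) t =
        mfderivWithin 𝓘(ℝ, ℝ) (𝓡 (2 * n)) (fun s ↦ φ' s p) (Icc 0 1) t := by
      refine Filter.EventuallyEq.mfderivWithin_eq (nhdsWithin_le_nhds ?_) ?_
      · filter_upwards [he] with s hs
        rw [hs.1]
      · rw [he.self_of_nhds.1]
    rw [h1, he.self_of_nhds.2]
    -- The type of `w` depends on `φ t p`, so the base point is rewritten while `w` is still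
    -- quantified.
    have h2 := h'.generates t ht p
    rw [← he.self_of_nhds.1] at h2
    exact h2 w

/-- Agreement on a whole neighbourhood of `a`, Hamiltonians included, makes the glued pair locally
equal to one of the two given ones. -/
theorem IsHamiltonianPath.glue {φ ψ : ℝ → Symp σ} {F G : ℝ → M → ℝ}
    (hφ : IsHamiltonianPath σ φ F) (hψ : IsHamiltonianPath σ ψ G) {a : ℝ}
    (h : ∀ᶠ t in 𝓝 a, φ t = ψ t ∧ F t = G t) :
    IsHamiltonianPath σ (fun t ↦ if t ≤ a then φ t else ψ t)
      (fun t ↦ if t ≤ a then F t else G t) := by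
  refine IsHamiltonianPath.of_locally fun t _ ↦ ?_
  rcases lt_trichotomy t a with ht | rfl | ht
  · refine ⟨φ, F, hφ, ?_⟩
    filter_upwards [eventually_lt_nhds ht] with s hs
    simp [hs.le]
  · refine ⟨φ, F, hφ, ?_⟩
    filter_upwards [h] with s hs
    simp [hs.1, hs.2]
  · refine ⟨ψ, G, hψ, ?_⟩
    filter_upwards [eventually_gt_nhds ht] with s hs
    simp [not_le.2 hs]

theorem mul_mem_Ham {f g : Symp σ} (hf : f ∈ Ham σ) (hg : g ∈ Ham σ) : f * g ∈ Ham σ := by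
  obtain ⟨φ, F, hφ, hφ0, rfl⟩ := hf
  obtain ⟨ψ, G, hψ, hψ0, rfl⟩ := hg
  -- With `b = 0` the transition ends at `1/3`, with `b = -2` it starts at `2/3`. In between, both
  -- paths rest at `ψ 1` with zero Hamiltonian, so they can be glued at `1/2`.
  have hs (b : ℝ) : ContDiff ℝ ∞ (fun t ↦ Real.smoothTransition (3 * t + b)) :=
    Real.smoothTransition.contDiff.comp (by fun_prop)
  have hm (b : ℝ) : MapsTo (fun t ↦ Real.smoothTransition (3 * t + b)) (Icc 0 1) (Icc 0 1) :=
    fun t _ ↦ ⟨Real.smoothTransition.nonneg _, Real.smoothTransition.le_one _⟩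
  have h1 : ∀ᶠ t in 𝓝 (1 / 2 : ℝ), Real.smoothTransition (3 * t + 0) = 1 := by
    filter_upwards [eventually_gt_nhds (show (1 / 3 : ℝ) < 1 / 2 by norm_num)] with t ht
    exact Real.smoothTransition.one_of_one_le (by linarith)
  have h2 : ∀ᶠ t in 𝓝 (1 / 2 : ℝ), Real.smoothTransition (3 * t + -2) = 0 := by
    filter_upwards [eventually_lt_nhds (show (1 / 2 : ℝ) < 2 / 3 by norm_num)] with t ht
    exact Real.smoothTransition.zero_of_nonpos (by linarith)
  refine ⟨_, _, (hψ.reparam_mul (hs 0) (hm 0) 1).glue (a := 1 / 2)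
    (hφ.reparam_mul (hs (-2)) (hm (-2)) (ψ 1)) ?_, ?_, ?_⟩
  · filter_upwards [h1.eventually_nhds, h2.eventually_nhds] with t ht1 ht2
    have d1 := Filter.EventuallyEq.deriv_eq (f := fun _ ↦ (1 : ℝ)) ht1
    have d2 := Filter.EventuallyEq.deriv_eq (f := fun _ ↦ (0 : ℝ)) ht2
    rw [d1, d2, ht1.self_of_nhds, ht2.self_of_nhds, hφ0]
    simp
  · norm_num [hψ0, Real.smoothTransition.zero]
  · norm_num [Real.smoothTransition.one]

theorem inv_mem_Ham {f : Symp σ} (hf : f ∈ Ham σ) : f⁻¹ ∈ Ham σ := by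
  obtain ⟨φ, F, hφ, hφ0, rfl⟩ := hf
  -- The reversed path, translated on the right so that it starts at the identity.
  refine ⟨_, _, hφ.reparam_mul (β := fun t ↦ 1 - t) (by fun_prop)
    (fun t ht ↦ ⟨by linarith [ht.2], by linarith [ht.1]⟩) (φ 1)⁻¹, ?_, ?_⟩
  · simp
  · simp [hφ0]

theorem hoferNorm_le {φ : ℝ → Symp σ} {F : ℝ → M → ℝ} (h : IsHamiltonianPath σ φ F)
    (h0 : φ 0 = 1) : hoferNorm σ (φ 1) ≤ hoferLength F :=
  csInf_le ⟨0, by rintro _ ⟨_, G, _, _, _, rfl⟩; exact hoferLength_nonneg G⟩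
    ⟨φ, F, h, h0, rfl, rfl⟩

/-- A Hamiltonian path is Lipschitz continuous with respect to the Hofer distance. -/
theorem IsHamiltonianPath.exists_hoferNorm_le [CompactSpace M] {φ : ℝ → Symp σ} {F : ℝ → M → ℝ}
    (h : IsHamiltonianPath σ φ F) : ∃ C, 0 ≤ C ∧ ∀ s ∈ Icc (0 : ℝ) 1, ∀ t ∈ Icc (0 : ℝ) 1,
      φ t * (φ s)⁻¹ ∈ Ham σ ∧ hoferNorm σ (φ t * (φ s)⁻¹) ≤ C * |t - s| := by
  obtain ⟨C, hC⟩ := (isCompact_Icc.prod isCompact_univ).exists_bound_of_continuousOn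
    h.smooth_function.continuousOn
  have hC' (t : ℝ) (ht : t ∈ Icc (0 : ℝ) 1) (p : M) : |F t p| ≤ max C 0 :=
    (hC (t, p) ⟨ht, mem_univ _⟩).trans (le_max_left _ _)
  refine ⟨max C 0, le_max_right _ _, fun s hs t ht ↦ ?_⟩
  -- The piece of the path between times `s` and `t`, run affinely over `[0,1]` (backwards if `t <
  -- s`). Its speed `t - s` supplies the Lipschitz factor.
  have hm : MapsTo (fun u : ℝ ↦ s + u * (t - s)) (Icc 0 1) (Icc 0 1) := fun u hu ↦
    ⟨by nlinarith [hu.1, hu.2, hs.1, ht.1], by nlinarith [hu.1, hu.2, hs.2, ht.2]⟩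
  have h1 := h.reparam_mul (β := fun u ↦ s + u * (t - s)) (by fun_prop) hm (φ s)⁻¹
  have e0 : φ (s + 0 * (t - s)) * (φ s)⁻¹ = 1 := by simp
  have e1 : φ (s + 1 * (t - s)) * (φ s)⁻¹ = φ t * (φ s)⁻¹ := by simp
  refine ⟨⟨_, _, h1, e0, e1⟩, ?_⟩
  have h2 := hoferNorm_le h1 e0
  simp only [e1] at h2
  refine h2.trans (hoferLength_le (by positivity) fun u hu p ↦ ?_)
  have hd : deriv (fun u : ℝ ↦ s + u * (t - s)) u = t - s := by simp
  rw [hd, abs_mul, mul_comm]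
  gcongr
  exact hC' _ (hm hu) p

end HamiltonianPaths

/-! ### Smooth paths are continuous in the `C^∞`-topology -/

/-- Induction on `j`: each derivative in the `E`-direction costs one order of joint smoothness,
which `∞` absorbs. -/
theorem ContDiffWithinAt.iteratedFDeriv_snd {X E F : Type*}
    [NormedAddCommGroup X] [NormedSpace ℝ X] [NormedAddCommGroup E] [NormedSpace ℝ E]
    [NormedAddCommGroup F] [NormedSpace ℝ F] {G : X → E → F} {s : Set X} {x : X} {u : E}
    (hx : x ∈ s) (h : ContDiffWithinAt ℝ ∞ (Function.uncurry G) (s ×ˢ univ) (x, u)) (j : ℕ) :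
    ContDiffWithinAt ℝ ∞ (fun q : X × E ↦ iteratedFDeriv ℝ j (G q.1) q.2) (s ×ˢ univ) (x, u) := by
  induction j with
  | zero =>
    have h0 (q : X × E) : iteratedFDeriv ℝ 0 (G q.1) q.2 =
        (continuousMultilinearCurryFin0 ℝ E F).symm (Function.uncurry G q) := rfl
    simp only [h0]
    exact (LinearIsometryEquiv.contDiff _).comp_contDiffWithinAt h
  | succ j ih =>
    have hd : ContDiffWithinAt ℝ ∞ (fun q : X × E ↦ fderiv ℝ (iteratedFDeriv ℝ j (G q.1)) q.2)
        (s ×ˢ univ) (x, u) := by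
      simp only [← fderivWithin_univ]
      refine ContDiffWithinAt.fderivWithin (n := ∞) (g := Prod.snd)
        (f := fun q : X × E ↦ iteratedFDeriv ℝ j (G q.1)) ?_ contDiffWithinAt_snd uniqueDiffOn_univ
        (by rfl) ⟨hx, mem_univ _⟩ (fun _ _ ↦ mem_univ _)
      -- The pair `q` serves as the parameter and a fresh second variable is differentiated; its
      -- `E`-component is dropped here.
      exact ih.comp (g := fun q : X × E ↦ iteratedFDeriv ℝ j (G q.1) q.2)
        (f := fun r : (X × E) × E ↦ (r.1.1, r.2)) ((x, u), u) (by fun_prop)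
        (fun r hr ↦ ⟨hr.1.1, mem_univ _⟩)
    simp only [iteratedFDeriv_succ_eq_comp_left]
    exact (continuousMultilinearCurryLeftEquiv ℝ (fun _ : Fin (j + 1) ↦ E)
      F).symm.toContinuousLinearEquiv.contDiff.comp_contDiffWithinAt hd

section

variable {n : ℕ} {M : Type*} [TopologicalSpace M] [ChartedSpace (EuclideanSpace ℝ (Fin (2 * n))) M]
  [IsManifold (𝓡 (2 * n)) ∞ M]

theorem contDiffWithinAt_mapInCharts {s : Set ℝ} {φ : ℝ → M → M} {t : ℝ} {p x y : M}
    (h : ContMDiffWithinAt (𝓘(ℝ, ℝ).prod (𝓡 (2 * n))) (𝓡 (2 * n)) ∞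
      (fun q : ℝ × M ↦ φ q.1 q.2) (s ×ˢ univ) (t, p))
    (hx : p ∈ (extChartAt (𝓡 (2 * n)) x).source)
    (hy : φ t p ∈ (extChartAt (𝓡 (2 * n)) y).source) :
    ContDiffWithinAt ℝ ∞ (Function.uncurry fun t ↦ mapInCharts (n := n) (φ t) x y) (s ×ˢ univ)
      (t, extChartAt (𝓡 (2 * n)) x p) := by
  have hp : (extChartAt (𝓡 (2 * n)) x).symm (extChartAt (𝓡 (2 * n)) x p) = p :=
    (extChartAt (𝓡 (2 * n)) x).left_inv hx
  have h1 : ContMDiffAt (𝓡 (2 * n)) (𝓡 (2 * n)) ∞ (extChartAt (𝓡 (2 * n)) x).symm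
      (extChartAt (𝓡 (2 * n)) x p) :=
    (contMDiffOn_extChartAt_symm x).contMDiffAt
      (extChartAt_target_mem_nhds' ((extChartAt (𝓡 (2 * n)) x).map_source hx))
  have h2 : ContMDiffAt (𝓡 (2 * n)) (𝓡 (2 * n)) ∞ (extChartAt (𝓡 (2 * n)) y) (φ t p) :=
    contMDiffAt_extChartAt' (by simpa using hy)
  have h3 : ContMDiffAt (𝓘(ℝ, ℝ).prod (𝓡 (2 * n))) (𝓘(ℝ, ℝ).prod (𝓡 (2 * n))) ∞
      (fun q : ℝ × EuclideanSpace ℝ (Fin (2 * n)) ↦ (q.1, (extChartAt (𝓡 (2 * n)) x).symm q.2))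
      (t, extChartAt (𝓡 (2 * n)) x p) :=
    contMDiffAt_fst.prodMk (h1.comp (t, extChartAt (𝓡 (2 * n)) x p) contMDiffAt_snd)
  rw [← hp] at h h2
  have h4 := ContMDiffWithinAt.comp (s := s ×ˢ (univ : Set (EuclideanSpace ℝ (Fin (2 * n)))))
    (t := s ×ˢ (univ : Set M))
    (t, extChartAt (𝓡 (2 * n)) x p) h h3.contMDiffWithinAt (fun q hq ↦ ⟨hq.1, mem_univ _⟩)
  have h5 := ContMDiffAt.comp_contMDiffWithinAt (t, extChartAt (𝓡 (2 * n)) x p) h2 h4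
  rw [← contMDiffWithinAt_iff_contDiffWithinAt]
  rw [modelWithCornersSelf_prod, ← chartedSpaceSelf_prod]
  exact h5

theorem continuousWithinAt_iteratedFDeriv_mapInCharts {s : Set ℝ} {φ : ℝ → M → M} {t : ℝ}
    {p x y : M} (ht : t ∈ s)
    (h : ContMDiffWithinAt (𝓘(ℝ, ℝ).prod (𝓡 (2 * n))) (𝓡 (2 * n)) ∞
      (fun q : ℝ × M ↦ φ q.1 q.2) (s ×ˢ univ) (t, p))
    (hx : p ∈ (extChartAt (𝓡 (2 * n)) x).source)
    (hy : φ t p ∈ (extChartAt (𝓡 (2 * n)) y).source) (j : ℕ) :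
    ContinuousWithinAt (fun q : ℝ × M ↦ iteratedFDeriv ℝ j (mapInCharts (n := n) (φ q.1) x y)
      (extChartAt (𝓡 (2 * n)) x q.2)) (s ×ˢ univ) (t, p) := by
  have h1 := ((contDiffWithinAt_mapInCharts h hx hy).iteratedFDeriv_snd ht j).continuousWithinAt
  have h2 : ContinuousAt (fun q : ℝ × M ↦ (q.1, extChartAt (𝓡 (2 * n)) x q.2)) (t, p) :=
    continuousAt_fst.prodMk
      (ContinuousAt.comp (x := (t, p)) (continuousAt_extChartAt' hx) continuousAt_snd)
  exact ContinuousWithinAt.comp (x := (t, p)) (s := s ×ˢ (univ : Set M))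
    (t := s ×ˢ (univ : Set (EuclideanSpace ℝ (Fin (2 * n)))))
    (f := fun q : ℝ × M ↦ (q.1, extChartAt (𝓡 (2 * n)) x q.2)) h1 h2.continuousWithinAt
    (fun q hq ↦ ⟨hq.1, mem_univ _⟩)

/-- A smooth path of symplectomorphisms is continuous in the `C^∞`-topology. -/
theorem continuousOn_smoothTopology {σ : SymplecticForm n M} {φ : ℝ → Symp σ} {s : Set ℝ}
    (h : ContMDiffOn (𝓘(ℝ, ℝ).prod (𝓡 (2 * n))) (𝓡 (2 * n)) ∞
      (fun q : ℝ × M ↦ φ q.1 q.2) (s ×ˢ univ)) :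
    @ContinuousOn ℝ (Symp σ) _ (smoothTopology σ) φ s := by
  rw [continuousOn_to_generateFrom_iff]
  rintro t ht U ⟨f, k, x, y, A, ε, hA, hAx, hfA, hε, rfl⟩ ⟨hmaps, hlt⟩
  -- The centre `f` of the neighbourhood need not be `φ t`. Viewed as a constant path, it has jets
  -- continuous in `p` by the same lemma.
  have hf : ContMDiffOn (𝓘(ℝ, ℝ).prod (𝓡 (2 * n))) (𝓡 (2 * n)) ∞
      (fun q : ℝ × M ↦ (fun _ : ℝ ↦ (f : M → M)) q.1 q.2) (s ×ˢ univ) :=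
    (ContMDiff.comp (show ContMDiff (𝓡 (2 * n)) (𝓡 (2 * n)) ∞ f from f.1.contMDiff)
      contMDiff_snd).contMDiffOn
  have key : ∀ p ∈ A, ∀ᶠ q : ℝ × M in 𝓝 (t, p), q.1 ∈ s →
      φ q.1 q.2 ∈ (extChartAt (𝓡 (2 * n)) y).source ∧ ∀ j ≤ k,
        ‖iteratedFDeriv ℝ j (mapInCharts (n := n) (φ q.1) x y) (extChartAt (𝓡 (2 * n)) x q.2) -
          iteratedFDeriv ℝ j (mapInCharts (n := n) f x y) (extChartAt (𝓡 (2 * n)) x q.2)‖ < ε := by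
    intro p hp
    have hq : (t, p) ∈ s ×ˢ (univ : Set M) := ⟨ht, mem_univ _⟩
    have h1 := (h (t, p) hq).continuousWithinAt.preimage_mem_nhdsWithin
      ((isOpen_extChartAt_source y).mem_nhds (hmaps hp))
    have h2 (j : ℕ) (hj : j ∈ Iic k) : ∀ᶠ q : ℝ × M in 𝓝[s ×ˢ univ] (t, p),
        ‖iteratedFDeriv ℝ j (mapInCharts (n := n) (φ q.1) x y) (extChartAt (𝓡 (2 * n)) x q.2) -
          iteratedFDeriv ℝ j (mapInCharts (n := n) f x y) (extChartAt (𝓡 (2 * n)) x q.2)‖ < ε := by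
      have c1 := continuousWithinAt_iteratedFDeriv_mapInCharts (φ := fun t ↦ φ t) ht (h (t, p) hq)
        (hAx hp) (hmaps hp) j
      have c2 := continuousWithinAt_iteratedFDeriv_mapInCharts (φ := fun _ ↦ f) ht
        (hf (t, p) hq) (hAx hp) (hfA hp) j
      exact (c1.sub c2).norm.tendsto.eventually_lt_const (hlt p hp j hj)
    have h3 := (Filter.eventually_all_finite (Set.finite_Iic k)).2 h2
    filter_upwards [eventually_nhdsWithin_iff.1 (Filter.Eventually.and h1 h3)] with q hq hqs
    exact hq ⟨hqs, mem_univ _⟩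
  -- Compactness of `A` turns the estimates near each `(t, p)` into one neighbourhood of `t` valid
  -- for all `p ∈ A`.
  have h4 := hA.eventually_forall_of_forall_eventually
    (P := fun u p ↦ u ∈ s → φ u p ∈ (extChartAt (𝓡 (2 * n)) y).source ∧ ∀ j ≤ k,
        ‖iteratedFDeriv ℝ j (mapInCharts (n := n) (φ u) x y) (extChartAt (𝓡 (2 * n)) x p) -
          iteratedFDeriv ℝ j (mapInCharts (n := n) f x y) (extChartAt (𝓡 (2 * n)) x p)‖ < ε) key
  refine mem_nhdsWithin_iff_eventually.2 ?_
  filter_upwards [h4] with u hu hus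
  exact ⟨fun p hp ↦ (hu p hp hus).1, fun p hp ↦ (hu p hp hus).2⟩

end

/-! ### The `ρ_K`-topology -/

section

variable {n : ℕ} {M : Type*} [TopologicalSpace M] [ChartedSpace (EuclideanSpace ℝ (Fin (2 * n))) M]
  [MeasurableSpace M] {σ : SymplecticForm n M}

theorem mem_Ham_of_rhoK_lt {K : ℝ} {f : Symp σ} (h : rhoK σ K f < K) : f ∈ Ham σ := by
  by_contra hf
  simp [rhoK, hf] at h

theorem rhoK_le_hoferNorm {K : ℝ} {f : Symp σ} (h : f ∈ Ham σ) : rhoK σ K f ≤ hoferNorm σ f := by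
  simp [rhoK, h]

/-- If `g` lies within `K` of `f`, then `f * g⁻¹ ∈ Ham σ`, so `f` and `g` are both in the subgroup
or both outside it. -/
theorem isClopen_Ham_rhoKTopology {K : ℝ} (hK : 0 < K) :
    @IsClopen (Symp₀ σ) (rhoKTopology σ K) {f | f.1 ∈ Ham σ} := by
  let := rhoKTopology σ K
  refine ⟨isOpen_compl_iff.1 ?_, ?_⟩
  · refine fun f hf ↦ ⟨K, hK, fun g hg hg' ↦ hf ?_⟩
    have := mul_mem_Ham (mem_Ham_of_rhoK_lt hg) hg'
    simpa using this
  · refine fun f hf ↦ ⟨K, hK, fun g hg ↦ ?_⟩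
    have := mul_mem_Ham (inv_mem_Ham (mem_Ham_of_rhoK_lt hg)) hf
    simpa using this

theorem IsHamiltonianPath.mem_Symp₀ [IsManifold (𝓡 (2 * n)) ∞ M]
    {φ : ℝ → Symp σ} {F : ℝ → M → ℝ} (h : IsHamiltonianPath σ φ F) (h0 : φ 0 = 1) {t : ℝ}
    (ht : t ∈ Icc (0 : ℝ) 1) : φ t ∈ Symp₀ σ := by
  let := smoothTopology σ
  have h1 : IsPreconnected (φ '' Icc 0 1) :=
    isPreconnected_Icc.image φ (continuousOn_smoothTopology h.smooth_path)
  exact h1.subset_connectedComponent ⟨0, by simp, h0⟩ ⟨t, ht, rfl⟩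

theorem IsHamiltonianPath.continuous_rhoKTopology [CompactSpace M] {φ : ℝ → Symp σ}
    {F : ℝ → M → ℝ} (h : IsHamiltonianPath σ φ F) (K : ℝ)
    (h0 : ∀ t ∈ Icc (0 : ℝ) 1, φ t ∈ Symp₀ σ) :
    @Continuous (Icc (0 : ℝ) 1) (Symp₀ σ) _ (rhoKTopology σ K) (fun t ↦ ⟨φ t, h0 t t.2⟩) := by
  obtain ⟨C, hC, hφ⟩ := h.exists_hoferNorm_le
  let := rhoKTopology σ K
  refine continuous_def.2 fun U hU ↦ isOpen_iff_mem_nhds.2 fun t ht ↦ ?_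
  obtain ⟨ε, hε, hεU⟩ := hU _ ht
  have h1 : Tendsto (fun s : Icc (0 : ℝ) 1 ↦ C * |(t : ℝ) - s|) (𝓝 t) (𝓝 (C * |(t : ℝ) - t|)) :=
    Continuous.tendsto (by fun_prop) t
  rw [sub_self, abs_zero, mul_zero] at h1
  filter_upwards [h1.eventually_lt_const hε] with s hs
  obtain ⟨h2, h3⟩ := hφ s s.2 t t.2
  exact hεU _ ((rhoK_le_hoferNorm h2).trans_lt (h3.trans_lt hs))

end

theorem mainTheorem10 (n : ℕ) (M : Type*) [TopologicalSpace M]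
    [ChartedSpace (EuclideanSpace ℝ (Fin (2 * n))) M] [IsManifold (𝓡 (2 * n)) ∞ M]
    [T2Space M] [CompactSpace M] [MeasurableSpace M] [BorelSpace M]
    (σ : SymplecticForm n M) (K : ℝ) (hK : 0 < K) :
    ((↑) : Symp₀ σ → Symp σ) ''
      @connectedComponent (Symp₀ σ) (rhoKTopology σ K) (Symp₀.id σ) = Ham σ := by
  let := rhoKTopology σ K
  apply Subset.antisymm
  · rintro _ ⟨f, hf, rfl⟩
    exact (isClopen_Ham_rhoKTopology hK).connectedComponent_subset one_mem_Ham hf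
  · rintro _ ⟨φ, F, h, h0, rfl⟩
    have hS (t : ℝ) (ht : t ∈ Icc (0 : ℝ) 1) : φ t ∈ Symp₀ σ := h.mem_Symp₀ h0 ht
    have hc := h.continuous_rhoKTopology K hS
    have := isPreconnected_range hc
    refine ⟨⟨φ 1, hS 1 (by simp)⟩, this.subset_connectedComponent ⟨⟨0, by simp⟩, ?_⟩
      ⟨⟨1, by simp⟩, rfl⟩, rfl⟩
    exact Subtype.ext h0
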